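/- Let $0<\lambda<\frac{4}{27}$, let $f(x,\lambda)=x+\frac{\lambda}{(1+x)^2}$ for $x>-1$, and let $x_1(\lambda)$ be the smaller of the two zeros of $f(\cdot,\lambda)$ in $(-1,0)$. For $\alpha\ge 0$ consider the system $$\dot u=v,\qquad \dot v=\alpha v-f(u+x_1(\lambda),\lambda)\qquad (u+x_1(\lambda)>-1),$$ which has a saddle at $(0,0)$. (It is the time-reversed system of $\ddot x+\alpha\dot x+x=-\lambda/(1+x)^2$, written with $u=x-x_1(\lambda)$.) Consider the branch of the unstable manifold of $(0,0)$ that points into the first quadrant, continued as long as $v>0$; that is, the set of points $(u(0),v(0))$ where $(u,v)$ is a solution on $(-\infty,0]$ that tends to $(0,0)$ as $t\to-\infty$ and satisfies $u>0$, $v>0$ on $(-\infty,0]$. For every $\alpha\ge0$ there is $\bar u(\alpha)\in(0,\infty]$ such that this branch is the graph of a function $v=\Phi(u;\alpha,\lambda)>0$, $0<u<\bar u(\alpha)$, and $\Phi$ extends continuously in $u$ by the value $0$ to $u=0$ and, if $\bar u(\alpha)<\infty$, to $u=\bar u(\alpha)$. For fixed $\lambda$, $\Phi(u;\alpha,\lambda)$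 is a strictly increasing function of $\alpha$: if $0\le\alpha_1<\alpha_2$ and $u>0$ is finite with $u\le\bar u(\alpha_1)$, then $u<\bar u(\alpha_2)$ and $\Phi(u;\alpha_1,\lambda)<\Phi(u;\alpha_2,\lambda)$. -/

import Mathlib

open Set Filter Topology

noncomputable section

namespace MassSpring

/-- The force `f(x, λ) = x + λ / (1 + x)²`, considered on the region `x > -1`. -/
def f (x lam : ℝ) : ℝ := x + lam / (1 + x) ^ 2

/-- The smaller stationary position `x₁(λ)`, the least zero of `f(·, λ)` in `(-1, 0)`.
For `0 < λ < 4/27` there are exactly two zeros there, and `(x₁(λ), 0)` is the saddle. -/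
def x₁ (lam : ℝ) : ℝ := sInf {x : ℝ | -1 < x ∧ x < 0 ∧ f x lam = 0}

/-- `(U, V)` solves, on the time interval `(-∞, 0]`, the time-reversed system centred at the saddle:
`u' = v`, `v' = α v - f(u + x₁(λ), λ)`, in the phase space `u + x₁(λ) > -1`. -/
def IsBackwardSolution (α lam : ℝ) (U V : ℝ → ℝ) : Prop :=
  ∀ t ≤ 0, -1 < U t + x₁ lam ∧
    HasDerivWithinAt U (V t) (Iic 0) t ∧
    HasDerivWithinAt V (α * V t - f (U t + x₁ lam) lam) (Iic 0) t

/-- The branch of the unstable manifold of the saddle `(0, 0)` that points into the first quadrant,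
continued as long as `v > 0`: the points reached at time `0` by the solutions that tend to the
saddle as `t → -∞` and lie in the open first quadrant at all times `t ≤ 0`. -/
def branch (α lam : ℝ) : Set (ℝ × ℝ) :=
  {p | ∃ U V : ℝ → ℝ, IsBackwardSolution α lam U V ∧
    Tendsto U atBot (𝓝 0) ∧ Tendsto V atBot (𝓝 0) ∧
    (∀ t ≤ 0, 0 < U t ∧ 0 < V t) ∧ (U 0, V 0) = p}

/-- The right end `ū(α, λ) ∈ (0, ∞]` of the projection of the branch to the `u`-axis. -/
def uBar (α lam : ℝ) : EReal := ⨆ p ∈ branch α lam, (p.1 : EReal)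

/-- `Φ(u; α, λ)`: the height `v` of the branch above `u`; the value is `0` where there is no point
of the branch above `u`, in particular at `u = 0` and at the end point `u = ū(α, λ)`. -/
def Φ (u α lam : ℝ) : ℝ := sSup {v : ℝ | (u, v) ∈ branch α lam}

end MassSpring

end

/-!
Write `a = 1 + x₁(λ)`. Then `0 < a < 2/3` and `λ = (1 - a) a²`, and along an orbit in the first
quadrant `v` is a function `φ` of `u` with `φ φ' = α φ - f`, `φ(0) = 0`. Integrated, this is
`φ² = 2α ∫₀ᵘ φ + W`, where `W` (`potential`) is an explicit primitive of `-2f`. The right-hand side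
is monotone in `φ` and in `α`, so no theory of invariant manifolds is needed: the Picard iterates
started at `0` increase, are bounded by a line `c u`, and converge to a continuous solution
(`profile`). Being a limit of iterates that are monotone in `α`, the profile is monotone in `α`; the
difference of the squares for two dampings then has the positive derivative `2 (α₂ φ₂ - α₁ φ₁)`,
which gives strictness (`profile_strictMono_damping`).

It remains to see that the branch is exactly the graph of `φ` over the interval `(0, ū)` on which
`φ` stays positive (`branch_eq_graph`). The integrated equation may have other solutions than `φ`,
but a solution `(U, V)` on the branch follows `φ` near the saddle: there `f < 0`, and
`D = V - φ(U)` satisfies `D' = (f/φ) D`, so that `D²` is nonincreasing in time, with the limit `0` at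
`-∞`. Later on it cannot leave the graph, by a Gronwall estimate for `V² - φ(U)²`,
with `φ²` read as the untruncated right-hand side `profileSq`
(`mem_positivitySet_of_solution`). Conversely, `U' = φ(U)` is solved by inverting the time map
`∫ du / φ(u)`, which reaches back to `-∞` because `φ(u) ≤ c u` (`exists_orbit`).
-/

namespace MassSpring

/-! ### The saddle and the potential -/

lemma x₁_spec {lam : ℝ} (h0 : 0 < lam) (h1 : lam < 4 / 27) :
    0 < 1 + x₁ lam ∧ 1 + x₁ lam < 2 / 3 ∧ lam = (1 - (1 + x₁ lam)) * (1 + x₁ lam) ^ 2 := by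
  set q : ℝ → ℝ := fun x => x * (1 + x) ^ 2 + lam with hq
  have hqc : Continuous q := by fun_prop
  have hset : {x : ℝ | -1 < x ∧ x < 0 ∧ f x lam = 0} = Icc (-1) 0 ∩ q ⁻¹' {0} := by
    ext x
    simp only [mem_ofPred_eq, mem_inter_iff, mem_Icc, mem_preimage, mem_singleton_iff, hq, f]
    constructor
    · rintro ⟨hx, hx', h⟩
      have : 1 + x ≠ 0 := by linarith
      field_simp at h
      exact ⟨⟨hx.le, hx'.le⟩, by simpa using h⟩
    · rintro ⟨⟨hx, hx'⟩, h⟩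
      have hx1 : x ≠ -1 := by rintro rfl; norm_num at h; linarith
      have hx0 : x ≠ 0 := by rintro rfl; norm_num at h; linarith
      have hlt := lt_of_le_of_ne hx hx1.symm
      have : 1 + x ≠ 0 := by linarith
      refine ⟨hlt, lt_of_le_of_ne hx' hx0, ?_⟩
      field_simp
      simpa using h
  have hcomp : IsCompact (Icc (-1 : ℝ) 0 ∩ q ⁻¹' {0}) :=
    isCompact_Icc.inter_right (isClosed_singleton.preimage hqc)
  obtain ⟨z, hz, hqz⟩ : (0 : ℝ) ∈ q '' Ioo (-1) (-1 / 3) := by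
    apply intermediate_value_Ioo' (by norm_num) hqc.continuousOn
    constructor
    · simp only [hq]; norm_num; linarith
    · simp only [hq]; norm_num; exact h0
  have hzmem : z ∈ Icc (-1 : ℝ) 0 ∩ q ⁻¹' {0} := ⟨⟨hz.1.le, by linarith [hz.2]⟩, hqz⟩
  have hmem := hcomp.sInf_mem ⟨z, hzmem⟩
  have hle : x₁ lam ≤ z := by
    unfold x₁; rw [hset]; exact csInf_le hcomp.bddBelow hzmem
  have hx : x₁ lam ∈ {x : ℝ | -1 < x ∧ x < 0 ∧ f x lam = 0} := by
    unfold x₁; rw [hset]; exact hmem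
  have hq0 : q (x₁ lam) = 0 := by rw [hset] at hx; exact hx.2
  simp only [hq] at hq0
  exact ⟨by linarith [hx.1], by linarith [hz.2], by linarith⟩

/-- Minus twice the potential energy of the force measured from the saddle at `a = 1 + x₁(λ)`, where
`λ = (1 - a) a²`; it is extended evenly to `u < 0`, so that it is continuous on the whole line. -/
noncomputable def potential (a u : ℝ) : ℝ := u ^ 2 * (2 * (1 - a) / (a + |u|) - 1)

lemma continuous_potential {a : ℝ} (ha : 0 < a) : Continuous (potential a) := by
  unfold potential
  have : ∀ u : ℝ, a + |u| ≠ 0 := fun u => by positivity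
  fun_prop (disch := assumption)

lemma hasDerivAt_potential {a u : ℝ} (ha : 0 < a) (hu : 0 < u) :
    HasDerivAt (potential a) (-2 * f (u + (a - 1)) ((1 - a) * a ^ 2)) u := by
  have h1 : HasDerivAt (fun u : ℝ => u ^ 2 * (2 * (1 - a) / (a + u) - 1)) _ u :=
    ((hasDerivAt_id u).pow 2).mul
      (((hasDerivAt_const u (2 * (1 - a))).div ((hasDerivAt_id u).const_add a)
        (by simp only [id]; positivity)).sub_const 1)
  have h2 : potential a =ᶠ[𝓝 u] fun u : ℝ => u ^ 2 * (2 * (1 - a) / (a + u) - 1) := by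
    filter_upwards [lt_mem_nhds hu] with x hx
    simp [potential, abs_of_pos hx]
  refine (h1.congr_of_eventuallyEq h2).congr_deriv ?_
  have : a + u ≠ 0 := by positivity
  have e : 1 + (u + (a - 1)) = a + u := by ring
  simp only [f, e, id]
  field_simp
  simp
  ring

lemma potential_le {a : ℝ} (ha : 0 < a) (ha' : a < 2 / 3) (u : ℝ) :
    potential a u ≤ 2 * (1 - a) / a * u ^ 2 := by
  have h : 2 * (1 - a) / (a + |u|) ≤ 2 * (1 - a) / a :=
    div_le_div_of_nonneg_left (by linarith) ha (by linarith [abs_nonneg u])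
  unfold potential
  nlinarith [sq_nonneg u]

lemma potential_pos {a u : ℝ} (ha : 0 < a) (hu : 0 < u) (hu' : u < 2 - 3 * a) :
    0 < potential a u := by
  unfold potential
  rw [abs_of_pos hu]
  have : 1 < 2 * (1 - a) / (a + u) := by rw [lt_div_iff₀ (by positivity)]; linarith
  have h2 : 0 < u ^ 2 := by positivity
  nlinarith

/-- Immediately to the right of the saddle the force is negative. -/
lemma force_neg {a u : ℝ} (ha : 0 < a) (ha' : a < 2 / 3) (hu : 0 < u)
    (hu' : u < a * (2 - 3 * a) / 2) : f (u + (a - 1)) ((1 - a) * a ^ 2) < 0 := by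
  have e : f (u + (a - 1)) ((1 - a) * a ^ 2)
      = u * (u ^ 2 + (3 * a - 1) * u - a * (2 - 3 * a)) / (a + u) ^ 2 := by
    have : a + u ≠ 0 := by positivity
    have e : 1 + (u + (a - 1)) = a + u := by ring
    simp only [f, e]
    field_simp
    ring
  rw [e]
  apply div_neg_of_neg_of_pos _ (by positivity)
  apply mul_neg_of_pos_of_neg hu
  have : u < 1 := by nlinarith
  nlinarith

/-! ### The profile of the branch as a monotone limit -/

/-- The Picard iterates of the integrated orbit equation `φ² = 2α ∫₀ᵘ φ + W`, started at `0`.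
The upper limit is `|u|`, so that every iterate is defined and nonnegative on the whole line;
only `u ≥ 0` is of interest. -/
noncomputable def profileIter (α : ℝ) (W : ℝ → ℝ) : ℕ → ℝ → ℝ
  | 0 => fun _ => 0
  | n + 1 => fun u => √(2 * α * (∫ s in (0 : ℝ)..|u|, profileIter α W n s) + W u)

/-- The limit of the Picard iterates, the least nonnegative solution of `φ² = 2α ∫₀ᵘ φ + W`
(up to truncation of negative values of the right-hand side). -/
noncomputable def profile (α : ℝ) (W : ℝ → ℝ) (u : ℝ) : ℝ := ⨆ n, profileIter α W n u

section Profile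

variable {α k : ℝ} {W : ℝ → ℝ}

lemma profileIter_nonneg (α : ℝ) (W : ℝ → ℝ) (n : ℕ) (u : ℝ) : 0 ≤ profileIter α W n u := by
  cases n with
  | zero => exact le_rfl
  | succ n => exact Real.sqrt_nonneg _

lemma continuous_profileIter (hW : Continuous W) (n : ℕ) : Continuous (profileIter α W n) := by
  induction n with
  | zero => exact continuous_const
  | succ n ih =>
    have h : Continuous fun u : ℝ => ∫ s in (0 : ℝ)..u, profileIter α W n s :=
      intervalIntegral.continuous_primitive (fun a b => ih.intervalIntegrable a b) 0
    exact (((continuous_const.mul (h.comp continuous_abs))).add hW).sqrt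

lemma profileIter_mono (hα : 0 ≤ α) (hW : Continuous W) (u : ℝ) :
    Monotone fun n => profileIter α W n u := by
  refine monotone_nat_of_le_succ fun n => ?_
  induction n generalizing u with
  | zero => exact profileIter_nonneg α W 1 u
  | succ n ih =>
    refine Real.sqrt_le_sqrt ?_
    have := intervalIntegral.integral_mono (μ := MeasureTheory.volume) (abs_nonneg u)
      ((continuous_profileIter hW n).intervalIntegrable _ _)
      ((continuous_profileIter hW (n + 1)).intervalIntegrable _ _) ih
    gcongr

lemma profileIter_mono_damping {α₁ α₂ : ℝ} (h1 : 0 ≤ α₁) (h2 : α₁ ≤ α₂) (hW : Continuous W)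
    (n : ℕ) (u : ℝ) : profileIter α₁ W n u ≤ profileIter α₂ W n u := by
  induction n generalizing u with
  | zero => exact le_rfl
  | succ n ih =>
    refine Real.sqrt_le_sqrt ?_
    have := intervalIntegral.integral_mono (μ := MeasureTheory.volume) (abs_nonneg u)
      ((continuous_profileIter hW n).intervalIntegrable _ _)
      ((continuous_profileIter hW n).intervalIntegrable _ _) ih
    have h0 : 0 ≤ ∫ s in (0 : ℝ)..|u|, profileIter α₁ W n s :=
      intervalIntegral.integral_nonneg (abs_nonneg u) fun s _ => profileIter_nonneg α₁ W n s
    have h3 : 0 ≤ α₂ := h1.trans h2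
    gcongr

/-- The line of slope `α + k + 1` is a supersolution, which bounds all iterates. -/
lemma profileIter_le (hα : 0 ≤ α) (hk : 0 ≤ k) (hW : Continuous W) (hWk : ∀ u, W u ≤ k * u ^ 2)
    (n : ℕ) (u : ℝ) : profileIter α W n u ≤ (α + k + 1) * |u| := by
  induction n generalizing u with
  | zero => exact mul_nonneg (by positivity) (abs_nonneg u)
  | succ n ih =>
    refine Real.sqrt_le_iff.mpr ⟨by positivity, ?_⟩
    have h : ∫ s in (0 : ℝ)..|u|, profileIter α W n s ≤ ∫ s in (0 : ℝ)..|u|, (α + k + 1) * s := by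
      refine intervalIntegral.integral_mono_on (abs_nonneg u)
        ((continuous_profileIter hW n).intervalIntegrable _ _)
        (Continuous.intervalIntegrable (by fun_prop) _ _) fun s hs => ?_
      simpa [abs_of_nonneg hs.1] using ih s
    rw [intervalIntegral.integral_const_mul, integral_id, sq_abs] at h
    have h' := mul_le_mul_of_nonneg_left h (show 0 ≤ 2 * α by positivity)
    rw [mul_pow, sq_abs]
    have hk' := hWk u
    have : 0 ≤ (α + k + 1) * (k + 1) * u ^ 2 - k * u ^ 2 := by
      have : 0 ≤ (α * (k + 1) + k * k + k + 1) * u ^ 2 := by positivity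
      nlinarith
    nlinarith

lemma tendsto_profileIter (hα : 0 ≤ α) (hk : 0 ≤ k) (hW : Continuous W)
    (hWk : ∀ u, W u ≤ k * u ^ 2) (u : ℝ) :
    Tendsto (fun n => profileIter α W n u) atTop (𝓝 (profile α W u)) :=
  tendsto_atTop_ciSup (profileIter_mono hα hW u)
    ⟨_, forall_mem_range.mpr fun n => profileIter_le hα hk hW hWk n u⟩

lemma profile_nonneg (α : ℝ) (W : ℝ → ℝ) (u : ℝ) : 0 ≤ profile α W u :=
  Real.iSup_nonneg fun n => profileIter_nonneg α W n u

lemma profile_le (hα : 0 ≤ α) (hk : 0 ≤ k) (hW : Continuous W) (hWk : ∀ u, W u ≤ k * u ^ 2)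
    (u : ℝ) : profile α W u ≤ (α + k + 1) * |u| :=
  le_of_tendsto' (tendsto_profileIter hα hk hW hWk u) fun n => profileIter_le hα hk hW hWk n u

lemma profile_mono_damping {α₁ α₂ : ℝ} (h1 : 0 ≤ α₁) (h2 : α₁ ≤ α₂) (hk : 0 ≤ k)
    (hW : Continuous W) (hWk : ∀ u, W u ≤ k * u ^ 2) (u : ℝ) :
    profile α₁ W u ≤ profile α₂ W u :=
  le_of_tendsto_of_tendsto' (tendsto_profileIter h1 hk hW hWk u)
    (tendsto_profileIter (h1.trans h2) hk hW hWk u)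
    fun n => profileIter_mono_damping h1 h2 hW n u

lemma intervalIntegrable_profile (hα : 0 ≤ α) (hk : 0 ≤ k) (hW : Continuous W)
    (hWk : ∀ u, W u ≤ k * u ^ 2) (b c : ℝ) :
    IntervalIntegrable (profile α W) MeasureTheory.volume b c := by
  have hm : Measurable (profile α W) :=
    measurable_of_tendsto_metrizable (fun n => (continuous_profileIter hW n).measurable)
      (tendsto_pi_nhds.mpr (tendsto_profileIter hα hk hW hWk))
  have hb : IntervalIntegrable (fun u : ℝ => (α + k + 1) * |u|) MeasureTheory.volume b c :=
    Continuous.intervalIntegrable (by fun_prop) _ _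
  refine hb.mono_fun hm.aestronglyMeasurable (Eventually.of_forall fun u => ?_)
  simp only [Real.norm_eq_abs]
  rw [abs_of_nonneg (profile_nonneg α W u)]
  exact (profile_le hα hk hW hWk u).trans (le_abs_self _)

/-- The square of the profile, before truncation: `2α ∫₀ᵘ φ + W`. -/
noncomputable def profileSq (α : ℝ) (W : ℝ → ℝ) (u : ℝ) : ℝ :=
  2 * α * (∫ s in (0 : ℝ)..|u|, profile α W s) + W u

lemma profile_eq_sqrt (hα : 0 ≤ α) (hk : 0 ≤ k) (hW : Continuous W)
    (hWk : ∀ u, W u ≤ k * u ^ 2) (u : ℝ) : profile α W u = √(profileSq α W u) := by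
  refine tendsto_nhds_unique ((tendsto_add_atTop_iff_nat 1).mpr
    (tendsto_profileIter hα hk hW hWk u)) ?_
  refine Tendsto.sqrt (Tendsto.add_const _ (Tendsto.const_mul _ ?_))
  refine intervalIntegral.tendsto_integral_filter_of_dominated_convergence
    (fun s => (α + k + 1) * |s|)
    (Eventually.of_forall fun n => (continuous_profileIter hW n).aestronglyMeasurable)
    (Eventually.of_forall fun n => Eventually.of_forall fun s _ => ?_)
    (Continuous.intervalIntegrable (by fun_prop) _ _)
    (Eventually.of_forall fun s _ => tendsto_profileIter hα hk hW hWk s)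
  rw [Real.norm_of_nonneg (profileIter_nonneg α W n s)]
  exact profileIter_le hα hk hW hWk n s

lemma profile_pos (hα : 0 ≤ α) (hk : 0 ≤ k) (hW : Continuous W)
    (hWk : ∀ u, W u ≤ k * u ^ 2) {u : ℝ} (hu : 0 < W u) : 0 < profile α W u := by
  rw [profile_eq_sqrt hα hk hW hWk]
  exact Real.sqrt_pos.mpr (add_pos_of_nonneg_of_pos (mul_nonneg (by positivity)
    (intervalIntegral.integral_nonneg (abs_nonneg u) fun s _ => profile_nonneg _ _ s)) hu)

lemma profile_zero (hα : 0 ≤ α) (hk : 0 ≤ k) (hW : Continuous W)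
    (hWk : ∀ u, W u ≤ k * u ^ 2) : profile α W 0 = 0 :=
  le_antisymm (by simpa using profile_le hα hk hW hWk 0) (profile_nonneg α W 0)

lemma continuous_profileSq (hα : 0 ≤ α) (hk : 0 ≤ k) (hW : Continuous W)
    (hWk : ∀ u, W u ≤ k * u ^ 2) : Continuous (profileSq α W) := by
  have h : Continuous fun u : ℝ => ∫ s in (0 : ℝ)..u, profile α W s :=
    intervalIntegral.continuous_primitive (intervalIntegrable_profile hα hk hW hWk) 0
  exact (continuous_const.mul (h.comp continuous_abs)).add hW

lemma continuous_profile (hα : 0 ≤ α) (hk : 0 ≤ k) (hW : Continuous W)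
    (hWk : ∀ u, W u ≤ k * u ^ 2) : Continuous (profile α W) := by
  rw [show profile α W = fun u => √(profileSq α W u) from
    funext (profile_eq_sqrt hα hk hW hWk)]
  exact (continuous_profileSq hα hk hW hWk).sqrt

lemma hasDerivAt_profileSq (hα : 0 ≤ α) (hk : 0 ≤ k) (hW : Continuous W)
    (hWk : ∀ u, W u ≤ k * u ^ 2) {u W' : ℝ} (hu : 0 < u) (hd : HasDerivAt W W' u) :
    HasDerivAt (profileSq α W) (2 * α * profile α W u + W') u := by
  have hc := continuous_profile hα hk hW hWk
  have h := ((intervalIntegral.integral_hasDerivAt_right (hc.intervalIntegrable 0 u)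
    (hc.stronglyMeasurableAtFilter _ _) hc.continuousAt).const_mul (2 * α)).add hd
  refine h.congr_of_eventuallyEq ?_
  filter_upwards [lt_mem_nhds hu] with x hx
  simp [profileSq, abs_of_pos hx]

lemma hasDerivAt_profile (hα : 0 ≤ α) (hk : 0 ≤ k) (hW : Continuous W)
    (hWk : ∀ u, W u ≤ k * u ^ 2) {u g : ℝ} (hu : 0 < u) (hd : HasDerivAt W (-2 * g) u)
    (hpos : 0 < profile α W u) :
    HasDerivAt (profile α W) (α - g / profile α W u) u := by
  have e := profile_eq_sqrt hα hk hW hWk u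
  have hsq : 0 < profileSq α W u := Real.sqrt_pos.mp (e ▸ hpos)
  have h := (hasDerivAt_profileSq hα hk hW hWk hu hd).sqrt hsq.ne'
  rw [← e] at h
  rw [show profile α W = fun u => √(profileSq α W u) from
    funext (profile_eq_sqrt hα hk hW hWk)] at h ⊢
  refine h.congr_deriv ?_
  have : √(profileSq α W u) ≠ 0 := (Real.sqrt_pos.mpr hsq).ne'
  field_simp
  ring

end Profile

/-! ### Solutions on the branch and the graph of a profile -/

/-- The points `u > 0` up to which the profile stays positive. -/
def positivitySet (φ : ℝ → ℝ) : Set ℝ := {u | 0 < u ∧ ∀ s ∈ Ioc 0 u, 0 < φ s}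

/-- A function with `|h'| ≤ C |h|` that vanishes at `a` stays `0`, because `h² exp(-2Ct)` is
nonincreasing. -/
lemma eq_zero_of_abs_deriv_le {h h' : ℝ → ℝ} {C a b : ℝ} (hab : a ≤ b)
    (hc : ContinuousOn h (Icc a b)) (hd : ∀ t ∈ Ioo a b, HasDerivAt h (h' t) t)
    (hle : ∀ t ∈ Ioo a b, |h' t| ≤ C * |h t|) (h0 : h a = 0) : h b = 0 := by
  have hanti : AntitoneOn (fun t => h t ^ 2 * Real.exp (-(2 * C) * t)) (Icc a b) := by
    refine antitoneOn_of_hasDerivWithinAt_nonpos (convex_Icc a b)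
      (f' := fun t => (2 * h t * h' t - 2 * C * h t ^ 2) * Real.exp (-(2 * C) * t))
      ((hc.pow 2).mul (Continuous.continuousOn (by fun_prop))) (fun t ht => ?_) (fun t ht => ?_)
    · rw [interior_Icc] at ht
      have hE : HasDerivAt (fun t : ℝ => Real.exp (-(2 * C) * t)) _ t :=
        ((hasDerivAt_id t).const_mul (-(2 * C))).exp
      refine ((((hd t ht).pow 2).mul hE).congr_deriv ?_).hasDerivWithinAt
      simp
      ring
    · rw [interior_Icc] at ht
      refine mul_nonpos_of_nonpos_of_nonneg ?_ (Real.exp_pos _).le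
      have h1 : h t * h' t ≤ |h t| * |h' t| := by rw [← abs_mul]; exact le_abs_self _
      have h2 := mul_le_mul_of_nonneg_left (hle t ht) (abs_nonneg (h t))
      have h3 : |h t| * (C * |h t|) = C * h t ^ 2 := by rw [← sq_abs (h t)]; ring
      linarith
  have := hanti (left_mem_Icc.mpr hab) (right_mem_Icc.mpr hab) hab
  simp only [h0] at this
  have h3 : h b ^ 2 ≤ 0 := by
    have hp := Real.exp_pos (-(2 * C) * b)
    by_contra! hcon
    have := mul_pos hcon hp
    linarith
  exact pow_eq_zero_iff two_ne_zero |>.mp (le_antisymm h3 (sq_nonneg _))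

/-- A solution that emanates from the saddle into the first quadrant lies on the graph of `φ = √y`,
where `y` solves the integrated orbit equation. Away from the saddle the comparison is between `V²`
and `y(U)`, whose difference `h` satisfies `|h'| ≤ 2α |h|` even where `y ≤ 0`; this is why the
profile cannot vanish while the solution still has `V > 0`. -/
lemma mem_positivitySet_of_solution {α : ℝ} {φ y g U V : ℝ → ℝ} (hα : 0 ≤ α)
    (hy : Continuous y) (hφ : ∀ u, φ u = √(y u))
    (hy' : ∀ u, 0 < u → HasDerivAt y (2 * α * φ u + -2 * g u) u)
    (hφ' : ∀ u, 0 < u → 0 < φ u → HasDerivAt φ (α - g u / φ u) u)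
    (hφc : Continuous φ) (hφ0 : φ 0 = 0)
    {δ : ℝ} (hδ : 0 < δ) (hδφ : ∀ u ∈ Ioo 0 δ, 0 < φ u) (hδg : ∀ u ∈ Ioo 0 δ, g u < 0)
    (hU : ∀ t ≤ 0, HasDerivWithinAt U (V t) (Iic 0) t)
    (hV : ∀ t ≤ 0, HasDerivWithinAt V (α * V t - g (U t)) (Iic 0) t)
    (hUlim : Tendsto U atBot (𝓝 0)) (hVlim : Tendsto V atBot (𝓝 0))
    (hpos : ∀ t ≤ 0, 0 < U t ∧ 0 < V t) :
    U 0 ∈ positivitySet φ ∧ V 0 = φ (U 0) := by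
  have hU' : ∀ t < 0, HasDerivAt U (V t) t := fun t ht =>
    (hU t ht.le).hasDerivAt (Iic_mem_nhds ht)
  have hV' : ∀ t < 0, HasDerivAt V (α * V t - g (U t)) t := fun t ht =>
    (hV t ht.le).hasDerivAt (Iic_mem_nhds ht)
  have hUc : ContinuousOn U (Iic 0) := fun t ht => (hU t ht).continuousWithinAt
  have hVc : ContinuousOn V (Iic 0) := fun t ht => (hV t ht).continuousWithinAt
  -- near the saddle `V - φ(U)` is contracted in forward time, and it is `0` at `t = -∞`
  obtain ⟨t₀, ht₀⟩ := eventually_atBot.mp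
    ((hUlim.eventually (gt_mem_nhds hδ)).and (eventually_lt_atBot (0 : ℝ)))
  have hneg : t₀ < 0 := (ht₀ t₀ le_rfl).2
  have hmem : ∀ t ≤ t₀, U t ∈ Ioo 0 δ := fun t ht =>
    ⟨(hpos t (ht.trans hneg.le)).1, (ht₀ t ht).1⟩
  have near : ∀ t ≤ t₀, V t = φ (U t) := by
    have hD : ∀ t ≤ t₀, HasDerivAt (fun t => (V t - φ (U t)) ^ 2)
        (2 * (g (U t) / φ (U t)) * (V t - φ (U t)) ^ 2) t := fun t ht => by
      have ht0 := ht.trans_lt hneg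
      have hp := hδφ _ (hmem t ht)
      have := (((hV' t ht0).sub ((hφ' _ (hmem t ht).1 hp).comp t (hU' t ht0))).pow 2)
      refine this.congr_deriv ?_
      simp only [Function.comp_apply, Pi.sub_apply]
      field_simp
      push_cast
      ring
    have hanti : AntitoneOn (fun t => (V t - φ (U t)) ^ 2) (Iic t₀) :=
      antitoneOn_of_hasDerivWithinAt_nonpos (convex_Iic t₀)
        (fun t ht => (hD t ht).continuousAt.continuousWithinAt)
        (fun t ht => (hD t (interior_subset (s := Iic t₀) ht : t ≤ t₀)).hasDerivWithinAt)
        fun t ht => by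
          have h := hmem t (interior_subset (s := Iic t₀) ht)
          exact mul_nonpos_of_nonpos_of_nonneg (mul_nonpos_of_nonneg_of_nonpos zero_le_two
            (div_nonpos_of_nonpos_of_nonneg (hδg _ h).le (hδφ _ h).le)) (sq_nonneg _)
    have hlim : Tendsto (fun t => (V t - φ (U t)) ^ 2) atBot (𝓝 0) := by
      have h := ((hVlim.sub ((hφc.tendsto 0).comp hUlim)).pow 2)
      simpa [hφ0] using h
    intro t ht
    have hle : (V t - φ (U t)) ^ 2 ≤ 0 :=
      ge_of_tendsto hlim (by
        filter_upwards [eventually_le_atBot t] with s hs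
        exact hanti (hs.trans ht) ht hs)
    exact sub_eq_zero.mp (pow_eq_zero_iff two_ne_zero |>.mp (le_antisymm hle (sq_nonneg _)))
  have hsq : ∀ t ≤ 0, V t ^ 2 = y (U t) := by
    intro t ht
    rcases le_total t t₀ with h | h
    · have hp := hδφ _ (hmem t h)
      rw [hφ] at hp
      rw [near t h, hφ, Real.sq_sqrt (Real.sqrt_pos.mp hp).le]
    · have hp := hδφ _ (hmem t₀ le_rfl)
      rw [hφ] at hp
      have hsub : Icc t₀ t ⊆ Iic 0 := fun s hs => hs.2.trans ht
      refine sub_eq_zero.mp (eq_zero_of_abs_deriv_le (C := 2 * α)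
        (h := fun s => V s ^ 2 - y (U s)) (h' := fun s => 2 * α * (V s * (V s - φ (U s)))) h
        (((hVc.mono hsub).pow 2).sub (hy.comp_continuousOn (hUc.mono hsub)))
        (fun s hs => ?_) (fun s hs => ?_) ?_)
      · have hs0 : s < 0 := hs.2.trans_le ht
        refine (((hV' s hs0).pow 2).sub
          ((hy' _ (hpos s hs0.le).1).comp s (hU' s hs0))).congr_deriv ?_
        push_cast
        ring
      · have hs0 : s ≤ 0 := hs.2.le.trans ht
        have hVp := (hpos s hs0).2
        rw [abs_mul, abs_of_nonneg (by positivity : 0 ≤ 2 * α)]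
        refine mul_le_mul_of_nonneg_left ?_ (by positivity)
        rw [hφ]
        rcases le_total 0 (y (U s)) with hy0 | hy0
        · have hnn := Real.sqrt_nonneg (y (U s))
          have e : V s ^ 2 - y (U s) = (V s + √(y (U s))) * (V s - √(y (U s))) := by
            linear_combination Real.sq_sqrt hy0
          rw [e, abs_mul, abs_mul, abs_of_pos hVp,
            abs_of_pos (by positivity : 0 < V s + √(y (U s)))]
          exact mul_le_mul_of_nonneg_right (by linarith) (abs_nonneg _)
        · rw [Real.sqrt_eq_zero_of_nonpos hy0, sub_zero, abs_of_pos (mul_pos hVp hVp)]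
          refine le_trans ?_ (le_abs_self _)
          nlinarith
      · rw [near t₀ le_rfl, hφ, Real.sq_sqrt (Real.sqrt_pos.mp hp).le, sub_self]
  have hφU : ∀ t ≤ 0, 0 < φ (U t) := fun t ht => by
    rw [hφ, ← hsq t ht, Real.sqrt_sq (hpos t ht).2.le]; exact (hpos t ht).2
  refine ⟨⟨(hpos 0 le_rfl).1, fun s hs => ?_⟩, ?_⟩
  · -- `U` takes every value in `(0, U 0]`
    obtain ⟨t, ht⟩ := eventually_atBot.mp
      ((hUlim.eventually (gt_mem_nhds hs.1)).and (eventually_lt_atBot (0 : ℝ)))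
    have ht' := ht t le_rfl
    obtain ⟨r, hr, rfl⟩ := intermediate_value_Icc ht'.2.le
      (hUc.mono fun r hr => hr.2) ⟨ht'.1.le, hs.2⟩
    exact hφU r hr.2
  · rw [hφ, ← hsq 0 le_rfl, Real.sqrt_sq (hpos 0 le_rfl).2.le]

/-- The orbit that runs along the graph of the profile. The time is a primitive of `1 / φ`; in the
variable `log u` its density `u / φ(u)` is bounded below by `1 / c`, so the time runs from `-∞`. -/
lemma exists_orbit {φ : ℝ → ℝ} {c u₀ : ℝ} (hφc : Continuous φ) (hφle : ∀ u, 0 ≤ u → φ u ≤ c * u)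
    (hu₀ : u₀ ∈ positivitySet φ) :
    ∃ U : ℝ → ℝ, U 0 = u₀ ∧ Tendsto U atBot (𝓝 0) ∧
      ∀ t ≤ 0, U t ∈ Ioc 0 u₀ ∧ HasDerivAt U (φ (U t)) t := by
  obtain ⟨hu0, hφpos⟩ := hu₀
  have hcpos : 0 < c := by
    have := (hφpos u₀ ⟨hu0, le_rfl⟩).trans_le (hφle u₀ hu0.le)
    exact pos_of_mul_pos_left this hu0.le
  -- the density is frozen to the right of `u₀`, so that the time map is a bijection of the line
  set m : ℝ → ℝ := fun r => Real.exp (min r (Real.log u₀)) with hm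
  have hmc : Continuous m := by fun_prop
  have hmmem : ∀ r, m r ∈ Ioc 0 u₀ := fun r =>
    ⟨Real.exp_pos _, (Real.exp_le_exp.mpr (min_le_right _ _)).trans (Real.exp_log hu0).le⟩
  set p : ℝ → ℝ := fun r => m r / φ (m r) with hp
  have hpc : Continuous p := hmc.div (hφc.comp hmc) fun r => (hφpos _ (hmmem r)).ne'
  have hple : ∀ r, 1 / c ≤ p r := fun r => by
    rw [hp, div_le_div_iff₀ hcpos (hφpos _ (hmmem r))]
    linarith [hφle _ (hmmem r).1.le]
  have hppos : ∀ r, 0 < p r := fun r => (by positivity : 0 < 1 / c).trans_le (hple r)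
  set τ : ℝ → ℝ := fun s => ∫ r in (Real.log u₀)..s, p r with hτ
  have hτd : ∀ s, HasDerivAt τ (p s) s := fun s =>
    intervalIntegral.integral_hasDerivAt_right (hpc.intervalIntegrable _ _)
      (hpc.stronglyMeasurableAtFilter _ _) hpc.continuousAt
  have hτmono : StrictMono τ := strictMono_of_hasDerivAt_pos hτd hppos
  have hτ0 : τ (Real.log u₀) = 0 := intervalIntegral.integral_same
  have hτc : Continuous τ := continuous_iff_continuousAt.mpr fun s => (hτd s).continuousAt
  have hmono : Monotone fun s => τ s - s / c :=
    monotone_of_hasDerivAt_nonneg (f' := fun s => p s - 1 / c)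
      (fun s => (hτd s).sub ((hasDerivAt_id s).div_const c)) fun s => sub_nonneg.mpr (hple s)
  have htop : Tendsto τ atTop atTop := by
    refine tendsto_atTop_mono' atTop (f₁ := fun s => s / c - Real.log u₀ / c) ?_
      (tendsto_atTop_add_const_right _ _ (tendsto_id.atTop_div_const hcpos))
    filter_upwards [eventually_ge_atTop (Real.log u₀)] with s hs
    have := hmono hs
    simp only [hτ0] at this
    linarith
  have hbot : Tendsto τ atBot atBot := by
    refine tendsto_atBot_mono' atBot (f₁ := fun s => s / c - Real.log u₀ / c) ?_
      (tendsto_atBot_add_const_right _ _ (tendsto_id.atBot_div_const hcpos))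
    filter_upwards [eventually_le_atBot (Real.log u₀)] with s hs
    have := hmono hs
    simp only [hτ0] at this
    linarith
  set e : ℝ ≃o ℝ := hτmono.orderIsoOfSurjective τ (hτc.surjective htop hbot) with he
  have heτ : ∀ t, τ (e.symm t) = t := fun t => e.apply_symm_apply t
  have he0 : e.symm 0 = Real.log u₀ := hτmono.injective (by rw [heτ, hτ0])
  have hed : ∀ t, HasDerivAt e.symm (p (e.symm t))⁻¹ t := fun t =>
    HasDerivAt.of_local_left_inverse e.symm.continuous.continuousAt (hτd _) (hppos _).ne'
      (Eventually.of_forall heτ)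
  refine ⟨fun t => Real.exp (e.symm t), by simp only [he0, Real.exp_log hu0],
    Real.tendsto_exp_atBot.comp e.symm.tendsto_atBot, fun t ht => ?_⟩
  have hle : e.symm t ≤ Real.log u₀ := he0 ▸ e.symm.monotone ht
  have hmt : m (e.symm t) = Real.exp (e.symm t) := by simp only [hm, min_eq_left hle]
  have hmem := hmmem (e.symm t)
  rw [hmt] at hmem
  refine ⟨hmem, (hed t).exp.congr_deriv ?_⟩
  simp only [hp, hmt, inv_div]
  field_simp

/-! ### Identification of the branch, of its end point and of `Φ` -/

lemma branch_eq_graph {α lam a : ℝ} (hα : 0 ≤ α) (ha : 0 < a) (ha' : a < 2 / 3)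
    (hx : x₁ lam = a - 1) (hlam : lam = (1 - a) * a ^ 2) :
    branch α lam = {p : ℝ × ℝ | p.1 ∈ positivitySet (profile α (potential a)) ∧
      p.2 = profile α (potential a) p.1} := by
  have hW := continuous_potential ha
  have hWk := potential_le ha ha'
  have hk : 0 ≤ 2 * (1 - a) / a := div_nonneg (by linarith) ha.le
  have hφ0 : profile α (potential a) 0 = 0 := profile_zero hα hk hW hWk
  have hφc := continuous_profile hα hk hW hWk
  have hφ' : ∀ u, 0 < u → 0 < profile α (potential a) u → HasDerivAt (profile α (potential a))
      (α - f (u + x₁ lam) lam / profile α (potential a) u) u := fun u hu hp => by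
    refine hasDerivAt_profile hα hk hW hWk hu ?_ hp
    rw [hx, hlam]
    exact hasDerivAt_potential ha hu
  ext ⟨u, v⟩
  simp only [branch, mem_ofPred_eq, Prod.mk.injEq]
  constructor
  · rintro ⟨U, V, hsol, hU, hV, hpos, rfl, rfl⟩
    refine mem_positivitySet_of_solution (δ := a * (2 - 3 * a) / 2) (y := profileSq α (potential a))
      (g := fun u => f (u + x₁ lam) lam) hα
      (continuous_profileSq hα hk hW hWk) (profile_eq_sqrt hα hk hW hWk) (fun u hu => ?_)
      hφ' hφc hφ0 ?_ (fun u hu => ?_) (fun u hu => ?_) (fun t ht => (hsol t ht).2.1)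
      (fun t ht => (hsol t ht).2.2) hU hV hpos
    · refine hasDerivAt_profileSq hα hk hW hWk hu ?_
      simp only [hx]
      rw [hlam]
      exact hasDerivAt_potential ha hu
    · have : 0 < 2 - 3 * a := by linarith
      positivity
    · refine profile_pos hα hk hW hWk (potential_pos ha hu.1 ?_)
      have := hu.2
      nlinarith
    · simp only [hx]
      rw [hlam]
      exact force_neg ha ha' hu.1 hu.2
  · rintro ⟨hu, rfl⟩
    obtain ⟨U, hU0, hUlim, hU⟩ := exists_orbit (c := α + 2 * (1 - a) / a + 1) hφc
      (fun s hs => by simpa only [abs_of_nonneg hs] using profile_le hα hk hW hWk s) hu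
    refine ⟨U, fun t => profile α (potential a) (U t), fun t ht => ?_, hUlim,
      by simpa [hφ0, Function.comp_def] using (hφc.tendsto 0).comp hUlim, fun t ht => ?_, hU0,
      by simp only [hU0]⟩
    · obtain ⟨hm, hd⟩ := hU t ht
      have hp := hu.2 _ hm
      refine ⟨by rw [hx]; linarith [hm.1], hd.hasDerivWithinAt, ?_⟩
      refine (((hφ' _ hm.1 hp).comp t hd).congr_deriv ?_).hasDerivWithinAt
      field_simp
    · exact ⟨(hU t ht).1.1, hu.2 _ (hU t ht).1⟩

section Graph

variable {α lam : ℝ} {φ : ℝ → ℝ}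

lemma mem_positivitySet_iff (hφ : Continuous φ)
    (hb : branch α lam = {p : ℝ × ℝ | p.1 ∈ positivitySet φ ∧ p.2 = φ p.1}) {u : ℝ} :
    u ∈ positivitySet φ ↔ 0 < u ∧ (u : EReal) < uBar α lam := by
  have hlt : (u : EReal) < uBar α lam ↔ ∃ w ∈ positivitySet φ, u < w := by
    simp only [uBar, hb, lt_iSup_iff, mem_ofPred_eq, EReal.coe_lt_coe_iff, Prod.exists]
    exact ⟨fun ⟨w, _, ⟨hw, _⟩, h⟩ => ⟨w, hw, h⟩, fun ⟨w, hw, h⟩ => ⟨w, _, ⟨hw, rfl⟩, h⟩⟩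
  rw [hlt]
  constructor
  · intro hu
    refine ⟨hu.1, ?_⟩
    obtain ⟨ε, hε, hball⟩ := Metric.eventually_nhds_iff.mp
      (hφ.continuousAt.eventually (lt_mem_nhds (hu.2 u ⟨hu.1, le_rfl⟩)))
    refine ⟨u + ε / 2, ⟨by linarith [hu.1], fun s hs => ?_⟩, by linarith⟩
    rcases le_or_gt s u with h | h
    · exact hu.2 s ⟨hs.1, h⟩
    · exact hball (by rw [Real.dist_eq, abs_of_pos (by linarith)]; linarith [hs.2])
  · rintro ⟨h0, w, hw, huw⟩
    exact ⟨h0, fun s hs => hw.2 s ⟨hs.1, hs.2.trans huw.le⟩⟩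

lemma Φ_eq_of_mem (hb : branch α lam = {p : ℝ × ℝ | p.1 ∈ positivitySet φ ∧ p.2 = φ p.1}) {u : ℝ}
    (hu : u ∈ positivitySet φ) : Φ u α lam = φ u := by
  have : {v : ℝ | (u, v) ∈ branch α lam} = {φ u} := by
    ext v; simp [hb, hu]
  rw [Φ, this, csSup_singleton]

lemma Φ_eq_zero_of_notMem (hb : branch α lam = {p : ℝ × ℝ | p.1 ∈ positivitySet φ ∧ p.2 = φ p.1})
    {u : ℝ} (hu : u ∉ positivitySet φ) : Φ u α lam = 0 := by
  have : {v : ℝ | (u, v) ∈ branch α lam} = ∅ := by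
    ext v; simp [hb, hu]
  rw [Φ, this, Real.sSup_empty]

/-- At the end points of `[0, ū]` the profile vanishes, in accordance with the junk value of `Φ`. -/
lemma Φ_eq_of_le_uBar (hφ : Continuous φ) (hφn : ∀ u, 0 ≤ φ u) (hφ0 : φ 0 = 0)
    (hb : branch α lam = {p : ℝ × ℝ | p.1 ∈ positivitySet φ ∧ p.2 = φ p.1}) {u : ℝ}
    (h0 : 0 ≤ u) (hu : (u : EReal) ≤ uBar α lam) : Φ u α lam = φ u := by
  by_cases hm : u ∈ positivitySet φ
  · exact Φ_eq_of_mem hb hm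
  · rw [Φ_eq_zero_of_notMem hb hm]
    rcases h0.eq_or_lt with rfl | h0
    · exact hφ0.symm
    · refine (hφn u).eq_of_not_lt fun hpos => hm ⟨h0, fun s hs => ?_⟩
      rcases hs.2.eq_or_lt with rfl | hsu
      · exact hpos
      · have : s ∈ positivitySet φ := (mem_positivitySet_iff hφ hb).mpr
          ⟨hs.1, (EReal.coe_lt_coe_iff.mpr hsu).trans_le hu⟩
        exact this.2 s ⟨hs.1, le_rfl⟩

end Graph

/-! ### Strict monotonicity in the damping -/

/-- On an interval where the profile with the smaller damping is positive, the difference of the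
squared profiles has the derivative `2 (α₂ φ₂ - α₁ φ₁) > 0`, because `φ₁ ≤ φ₂` already holds. -/
lemma profile_strictMono_damping {α₁ α₂ k : ℝ} {W W' : ℝ → ℝ} (h1 : 0 ≤ α₁) (h2 : α₁ < α₂)
    (hk : 0 ≤ k) (hW : Continuous W) (hWk : ∀ u, W u ≤ k * u ^ 2)
    (hd : ∀ u, 0 < u → HasDerivAt W (W' u) u) {u : ℝ} (hu : 0 < u)
    (hpos : ∀ s ∈ Ioo 0 u, 0 < profile α₁ W s) : profile α₁ W u < profile α₂ W u := by
  have hα₂ := h1.trans h2.le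
  have hmono : StrictMonoOn (fun s => profileSq α₂ W s - profileSq α₁ W s) (Icc 0 u) := by
    refine strictMonoOn_of_hasDerivWithinAt_pos (convex_Icc 0 u)
      (f' := fun s => 2 * (α₂ * profile α₂ W s - α₁ * profile α₁ W s))
      ((continuous_profileSq hα₂ hk hW hWk).sub
        (continuous_profileSq h1 hk hW hWk)).continuousOn (fun s hs => ?_) (fun s hs => ?_)
    · rw [interior_Icc] at hs
      refine (((hasDerivAt_profileSq hα₂ hk hW hWk hs.1 (hd s hs.1)).sub
        (hasDerivAt_profileSq h1 hk hW hWk hs.1 (hd s hs.1))).congr_deriv ?_).hasDerivWithinAt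
      ring
    · rw [interior_Icc] at hs
      have hle := profile_mono_damping h1 h2.le hk hW hWk s
      have h := hpos s hs
      have := mul_le_mul_of_nonneg_left hle hα₂
      have := mul_lt_mul_of_pos_right h2 h
      linarith
  have h := hmono (left_mem_Icc.mpr hu.le) (right_mem_Icc.mpr hu.le) hu
  simp only [profileSq, abs_zero, intervalIntegral.integral_same, mul_zero, sub_self] at h
  have hlt : profileSq α₁ W u < profileSq α₂ W u := by
    simp only [profileSq]; linarith
  rw [profile_eq_sqrt h1 hk hW hWk, profile_eq_sqrt hα₂ hk hW hWk]
  refine Real.sqrt_lt_sqrt ?_ hlt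
  refine ge_of_tendsto (x := 𝓝[<] u)
    ((continuous_profileSq h1 hk hW hWk).continuousAt.tendsto.mono_left nhdsWithin_le_nhds) ?_
  filter_upwards [Ioo_mem_nhdsLT hu] with s hs
  have := hpos s hs
  rw [profile_eq_sqrt h1 hk hW hWk] at this
  exact (Real.sqrt_pos.mp this).le

end MassSpring

open MassSpring in
theorem proposition7 (lam : ℝ) (hlam₀ : 0 < lam) (hlam₁ : lam < 4 / 27) :
    -- for every `α ≥ 0` the branch is the graph of `Φ` over `(0, ū)`, and `Φ` is continuous on
    -- `[0, ū]` with `Φ = 0` at `0` and, when `ū` is finite, at `ū`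
    (∀ α : ℝ, 0 ≤ α →
      0 < MassSpring.uBar α lam ∧
      MassSpring.branch α lam =
        {p : ℝ × ℝ | 0 < p.1 ∧ (p.1 : EReal) < MassSpring.uBar α lam ∧
          p.2 = MassSpring.Φ p.1 α lam} ∧
      ContinuousOn (fun u : ℝ => MassSpring.Φ u α lam)
        {u : ℝ | 0 ≤ u ∧ (u : EReal) ≤ MassSpring.uBar α lam} ∧
      MassSpring.Φ 0 α lam = 0 ∧
      (∀ u : ℝ, (u : EReal) = MassSpring.uBar α lam → MassSpring.Φ u α lam = 0)) ∧
    -- `Φ` is strictly increasing in `α`, wherever it is defined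
    (∀ α₁ α₂ : ℝ, 0 ≤ α₁ → α₁ < α₂ →
      ∀ u : ℝ, 0 < u → (u : EReal) ≤ MassSpring.uBar α₁ lam →
        (u : EReal) < MassSpring.uBar α₂ lam ∧
        MassSpring.Φ u α₁ lam < MassSpring.Φ u α₂ lam) := by
  obtain ⟨ha, ha', hlam⟩ := x₁_spec hlam₀ hlam₁
  obtain ⟨a, hadef⟩ : ∃ a, a = 1 + x₁ lam := ⟨_, rfl⟩
  rw [← hadef] at ha ha' hlam
  have hx : x₁ lam = a - 1 := by linarith
  have hW := continuous_potential ha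
  have hWk := potential_le ha ha'
  have hk : 0 ≤ 2 * (1 - a) / a := div_nonneg (by linarith) ha.le
  have hb : ∀ α : ℝ, 0 ≤ α → _ := fun α hα => branch_eq_graph hα ha ha' hx hlam
  have hc : ∀ α : ℝ, 0 ≤ α → _ := fun α hα => continuous_profile hα hk hW hWk
  have hφ0 : ∀ α : ℝ, 0 ≤ α → profile α (potential a) 0 = 0 := fun α hα =>
    profile_zero hα hk hW hWk
  have hΦ : ∀ α : ℝ, 0 ≤ α → ∀ u : ℝ, 0 ≤ u → (u : EReal) ≤ uBar α lam →
      Φ u α lam = profile α (potential a) u := fun α hα u h0 hu =>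
    Φ_eq_of_le_uBar (hc α hα) (profile_nonneg α _) (hφ0 α hα) (hb α hα) h0 hu
  constructor
  · intro α hα
    have hS := fun u => mem_positivitySet_iff (u := u) (hc α hα) (hb α hα)
    have hmem : 1 - 3 * a / 2 ∈ positivitySet (profile α (potential a)) :=
      ⟨by linarith, fun s hs => profile_pos hα hk hW hWk
        (potential_pos ha hs.1 (by linarith [hs.2]))⟩
    have hpos : 0 < uBar α lam :=
      (EReal.coe_pos.mpr hmem.1).trans ((hS _).mp hmem).2
    refine ⟨hpos, ?_, ?_, ?_, fun u hu => Φ_eq_zero_of_notMem (hb α hα) fun h =>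
      ((hS u).mp h).2.ne hu⟩
    · rw [hb α hα]
      ext ⟨u, v⟩
      simp only [mem_ofPred_eq, hS, and_assoc]
      refine and_congr_right fun h0 => and_congr_right fun h => ?_
      rw [hΦ α hα u h0.le h.le]
    · exact (hc α hα).continuousOn.congr fun u hu => hΦ α hα u hu.1 hu.2
    · rw [hΦ α hα 0 le_rfl (by simpa using hpos.le), hφ0 α hα]
  · intro α₁ α₂ h1 h2 u hu hle
    have hα₂ := h1.trans h2.le
    have hlt : ∀ s ∈ Ioc 0 u, profile α₁ (potential a) s < profile α₂ (potential a) s := by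
      intro s hs
      refine profile_strictMono_damping h1 h2 hk hW hWk
        (fun r hr => hasDerivAt_potential ha hr) hs.1 fun r hr => ?_
      have hr' : r ∈ positivitySet (profile α₁ (potential a)) :=
        (mem_positivitySet_iff (hc α₁ h1) (hb α₁ h1)).mpr
          ⟨hr.1, (EReal.coe_lt_coe_iff.mpr (hr.2.trans_le hs.2)).trans_le hle⟩
      exact hr'.2 r ⟨hr.1, le_rfl⟩
    have hmem : u ∈ positivitySet (profile α₂ (potential a)) :=
      ⟨hu, fun s hs => (profile_nonneg _ _ s).trans_lt (hlt s hs)⟩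
    refine ⟨((mem_positivitySet_iff (hc α₂ hα₂) (hb α₂ hα₂)).mp hmem).2, ?_⟩
    rw [hΦ α₁ h1 u hu.le hle, Φ_eq_of_mem (hb α₂ hα₂) hmem]
    exact hlt u ⟨hu, le_rfl⟩
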